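/- Fix a nonstandard extension $*$, that is, an assignment $X\mapsto{}^*X$, $f\mapsto{}^*f$ on sets and maps that satisfies the transfer principle (no particular construction is required). Let $B$ be an internal Dedekind ring, i.e. an element of ${}^*\mathcal D$ for some set $\mathcal D$ of Dedekind domains (e.g. an ultraproduct of Dedekind domains). Let $\mathcal M$ be the set of internal maximal ideals of $B$ and let $\mathcal L={}^*\mathcal P_{fin}(\mathcal M)$ be the lattice of hyperfinite subsets of $\mathcal M$. A filter on $\mathcal L$ is a subset closed under $\cap$ and under passing to larger sets of $\mathcal L$; an ultrafilter is a maximal proper filter. For $a\in B$ put $V(a)=\{\mathfrak p\in\mathcal M\mid a\in\mathfrak p\}$. Let $\mathfrak m$ be a (not necessarily internal) maximal ideal of $B$ and let $\mathcal F$ be the filter on $\mathcal L$ generated by the sets $V(a)$, $a\in\mathfrak m$, i.e. the set of all $S\in\mathcal L$ that contain $V(a_1)\cap\dots\cap V(a_n)$ for some finitely many $a_1,\dots,a_n\in\mathfrak m$. Then: 1. $\mathcal F$ is an ultrafilter on $\mathcal L$, and it corresponds to $\mathfrak m$: $\mathfrak m=\{a\in B\mid a=0 \text{ or } V(a)\in\mathcal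 F\}$. 2. Let ${}^*\prod_{\mathfrak p\in\mathcal M}B/\mathfrak p$ be the ring of internal functions $f$ on $\mathcal M$ with $f(\mathfrak p)$ in the internal residue field $B/\mathfrak p$ for all $\mathfrak p \in \mathcal M$, and let $\big({}^*\prod_{\mathfrak p\in\mathcal M}B/\mathfrak p\big)/\mathcal F$ be its quotient in which two functions are identified if they agree on some $F\in\mathcal F$. The diagonal map $b\mapsto(b \bmod \mathfrak p)_{\mathfrak p}$ induces a ring isomorphism $$B/\mathfrak m\;\cong\;\Big({}^*\prod_{\mathfrak p\in\mathcal M}B/\mathfrak p\Big)\Big/\mathcal F .$$ 3. If $\mathfrak m$ is internal, then $\mathfrak m \in \mathcal M$, the ultrafilter $\mathcal F$ is principal with least element $\{\mathfrak m\}$, and evaluation of functions at $\mathfrak m$ induces an isomorphism of the ultraproduct $\big({}^*\prod_{\mathfrak p\in\mathcal M}B/\mathfrak p\big)/\mathcal F$ onto the internal residue field $B/\mathfrak m$; moreover the internal residue field at $\mathfrak m$ is the ordinary quotient ring $B/\mathfrak m$, via $b\mapsto b\bmod\mathfrak m$. -/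

import Mathlib

universe u v

/-- A nonstandard extension (in its functorial form): every set `X` has an extension `*X`, every map
`f : X → Y` has an extension `*f : *X → *Y`, compatibly with identities and composition, and
`*` preserves the one-point set, binary products and disjoint unions.

These axioms are the transfer principle: preservation of disjoint unions makes `*` commute with
the Boolean operations on subsets (so with `∧`, `∨`, `¬`), preservation of products lets formulas
have several variables and makes equality transfer, and preservation of surjections (they split)
makes `∃` transfer.  Sets of higher type are covered because `X` may itself be a set of subsets, of
functions, of ideals, and so on; the elements of `*(Set X)` are the internal subsets of `*X`.
The map `X ↦ X^J / U` for any ultrafilter `U` on any set `J` is an example, but no particular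
construction is required, and no saturation is imposed. -/
structure NonstandardExtension where
  /-- the extension `*X` of a set `X` -/
  star : Type u → Type v
  /-- the extension `*f` of a map `f` -/
  map : ∀ {X Y : Type u}, (X → Y) → star X → star Y
  map_id : ∀ {X : Type u} (x : star X), map (fun y : X => y) x = x
  map_map : ∀ {X Y Z : Type u} (g : Y → Z) (f : X → Y) (x : star X),
    map g (map f x) = map (fun y => g (f y)) x
  existsUnique_star_punit : ∃! _x : star PUnit.{u + 1}, True
  bijective_prod : ∀ X Y : Type u, Function.Bijective
    (fun z : star (X × Y) => (map Prod.fst z, map Prod.snd z))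
  bijective_sum : ∀ X Y : Type u, Function.Bijective
    (Sum.elim (map Sum.inl) (map Sum.inr) : star X ⊕ star Y → star (X ⊕ Y))

namespace NonstandardExtension

variable (E : NonstandardExtension.{u, v})

/-- The extension `*s ⊆ *X` of a subset `s ⊆ X`. -/
def starSet {X : Type u} (s : Set X) : Set (E.star X) :=
  Set.range (E.map (Subtype.val : s → X))

section Transfer

variable {X Y : Type u}

theorem map_inl_ne_map_inr (x : E.star X) (y : E.star Y) :
    E.map (Sum.inl : X → X ⊕ Y) x ≠ E.map (Sum.inr : Y → X ⊕ Y) y := by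
  intro h
  have := (E.bijective_sum X Y).1 (a₁ := Sum.inl x) (a₂ := Sum.inr y) h
  cases this

theorem isEmpty_star [IsEmpty X] : IsEmpty (E.star X) := by
  refine ⟨fun x => E.map_inl_ne_map_inr x x ?_⟩
  congr 1
  funext a
  exact isEmptyElim a

theorem map_injective {f : X → Y} (hf : Function.Injective f) : Function.Injective (E.map f) := by
  rcases isEmpty_or_nonempty X with h | h
  · intro x
    exact (E.isEmpty_star (X := X)).elim x
  · intro x y hxy
    have h2 := congrArg (E.map (Function.invFun f)) hxy
    simp only [E.map_map, Function.leftInverse_invFun hf _] at h2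
    simpa only [E.map_id] using h2

theorem map_mem_starSet_of_forall (f : X → Y) (t : Set Y) (h : ∀ x, f x ∈ t) (x : E.star X) :
    E.map f x ∈ E.starSet t :=
  ⟨E.map (fun y => ⟨f y, h y⟩) x, by rw [E.map_map]⟩

theorem mem_starSet_or (s : Set X) (x : E.star X) : x ∈ E.starSet s ∨ x ∈ E.starSet sᶜ := by
  classical
  let g : X → s ⊕ (sᶜ : Set X) := fun y => if h : y ∈ s then Sum.inl ⟨y, h⟩ else Sum.inr ⟨y, h⟩
  let k : s ⊕ (sᶜ : Set X) → X := Sum.elim Subtype.val Subtype.val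
  have hkg : ∀ y, k (g y) = y := by
    intro y
    by_cases h : y ∈ s <;> simp [k, g, h]
  have hx : x = E.map k (E.map g x) := by
    rw [E.map_map]
    simp only [hkg, E.map_id]
  obtain ⟨z | z, hz⟩ := (E.bijective_sum s (sᶜ : Set X)).2 (E.map g x)
  · left
    refine ⟨z, ?_⟩
    rw [hx, ← hz, Sum.elim_inl, E.map_map]
    rfl
  · right
    refine ⟨z, ?_⟩
    rw [hx, ← hz, Sum.elim_inr, E.map_map]
    rfl

theorem notMem_starSet_compl (s : Set X) (x : E.star X) (h : x ∈ E.starSet s) :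
    x ∉ E.starSet sᶜ := by
  classical
  obtain ⟨y, rfl⟩ := h
  rintro ⟨z, hz⟩
  let g : X → s ⊕ (sᶜ : Set X) := fun y => if h : y ∈ s then Sum.inl ⟨y, h⟩ else Sum.inr ⟨y, h⟩
  have h1 : ∀ y : s, g y.1 = Sum.inl y := fun y => by simp [g, y.2]
  have h2 : ∀ y : (sᶜ : Set X), g y.1 = Sum.inr y := fun y => by
    have : y.1 ∉ s := y.2
    simp [g, this]
  have h3 := congrArg (E.map g) hz
  simp only [E.map_map, h1, h2] at h3
  exact E.map_inl_ne_map_inr _ _ h3.symm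

theorem map_mem_starSet (f : X → Y) (t : Set Y) (x : E.star X) :
    E.map f x ∈ E.starSet t ↔ x ∈ E.starSet (f ⁻¹' t) := by
  have key : ∀ t : Set Y, x ∈ E.starSet (f ⁻¹' t) → E.map f x ∈ E.starSet t := by
    rintro t ⟨y, rfl⟩
    rw [E.map_map]
    exact E.map_mem_starSet_of_forall _ _ (fun z => z.2) y
  refine ⟨fun h => ?_, key t⟩
  rcases E.mem_starSet_or (f ⁻¹' t) x with h1 | h1
  · exact h1
  · exact absurd (key tᶜ h1) (E.notMem_starSet_compl _ _ h)

theorem starSet_mono {s t : Set X} (h : s ⊆ t) : E.starSet s ⊆ E.starSet t := by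
  rintro _ ⟨y, rfl⟩
  exact E.map_mem_starSet_of_forall _ _ (fun z => h z.2) y

theorem mem_starSet_inter {s t : Set X} {x : E.star X} (hs : x ∈ E.starSet s)
    (ht : x ∈ E.starSet t) : x ∈ E.starSet (s ∩ t) := by
  obtain ⟨y, rfl⟩ := hs
  rw [E.map_mem_starSet] at ht
  obtain ⟨z, rfl⟩ := ht
  rw [E.map_map]
  exact E.map_mem_starSet_of_forall (fun z : ((Subtype.val : s → X) ⁻¹' t) => z.1.1) (s ∩ t)
    (fun z => ⟨z.1.2, z.2⟩) z

theorem mem_starSet_eq {f g : X → Y} {x : E.star X} (h : E.map f x = E.map g x) :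
    x ∈ E.starSet {y | f y = g y} := by
  rcases E.mem_starSet_or {y | f y = g y} x with h1 | h1
  · exact h1
  · exfalso
    let Δ : Set (Y × Y) := {z | z.1 = z.2}
    have e : E.map (fun y => (f y, g y)) x = E.map (fun y => (f y, f y)) x := by
      apply (E.bijective_prod Y Y).1
      simp only [E.map_map, Prod.mk.injEq, true_and]
      exact h.symm
    have h2 : E.map (fun y => (f y, f y)) x ∈ E.starSet Δ :=
      E.map_mem_starSet_of_forall (fun y => (f y, f y)) Δ (fun _ => rfl) x
    rw [← e, E.map_mem_starSet] at h2
    exact E.notMem_starSet_compl _ _ h2 h1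

end Transfer

variable {I : Type u}

/-- Let `T = (T i)` be a family of sets indexed by `I` and `i₀ ∈ *I`.  This is the internal set
`*T_{i₀}`, the value at `i₀` of the extended family, i.e. the fibre over `i₀` of
`*(⨆ T i) → *I`.  The internal sets that are elements of `*{T i}` are exactly these.  (For an
ultrapower and `i₀` the class of `(i_j)_j` it is the ultraproduct of the sets `T (i_j)`.) -/
def Internal (i₀ : E.star I) (T : I → Type u) : Type v :=
  {x : E.star (Σ i, T i) // E.map Sigma.fst x = i₀}

namespace Internal

variable {E} {i₀ : E.star I} {T T₁ T₂ T₃ : I → Type u}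

/-- The internal map `*T_{i₀} → *T₁_{i₀}` given by a family of maps `T i → T₁ i`. -/
def map (f : ∀ i, T i → T₁ i) (x : E.Internal i₀ T) : E.Internal i₀ T₁ :=
  ⟨E.map (fun z => ⟨z.1, f z.1 z.2⟩) x.1, by rw [E.map_map]; exact x.2⟩

/-- The internal element given by a family of elements. -/
def const (c : ∀ i, T i) : E.Internal i₀ T :=
  ⟨E.map (fun i => ⟨i, c i⟩) i₀, by rw [E.map_map]; exact E.map_id _⟩

/-- The internal statement `*P(x)`, where `P` is a family of predicates. -/
def Holds (P : ∀ i, T i → Prop) (x : E.Internal i₀ T) : Prop :=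
  x.1 ∈ E.starSet {z : Σ i, T i | P z.1 z.2}

theorem map_map (g : ∀ i, T₁ i → T₂ i) (f : ∀ i, T i → T₁ i) (x : E.Internal i₀ T) :
    map g (map f x) = map (fun i y => g i (f i y)) x :=
  Subtype.ext (E.map_map _ _ _)

theorem map_id (x : E.Internal i₀ T) : map (fun _ y => y) x = x :=
  Subtype.ext (E.map_id _)

theorem map_const (f : ∀ i, T i → T₁ i) (c : ∀ i, T i) :
    map f (const c : E.Internal i₀ T) = const (fun i => f i (c i)) :=
  Subtype.ext (E.map_map _ _ _)

theorem const_eq_map (c : ∀ i, T₁ i) (x : E.Internal i₀ T) :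
    (const c : E.Internal i₀ T₁) = map (fun i _ => c i) x := by
  obtain ⟨x, rfl⟩ := x
  exact Subtype.ext (E.map_map _ _ _)

theorem exists_pair (x : E.Internal i₀ T₁) (y : E.Internal i₀ T₂) :
    ∃ w : E.Internal i₀ (fun i => T₁ i × T₂ i),
      map (fun _ z => z.1) w = x ∧ map (fun _ z => z.2) w = y := by
  obtain ⟨z, hz⟩ := (E.bijective_prod (Σ i, T₁ i) (Σ i, T₂ i)).2 (x.1, y.1)
  obtain ⟨hx, hy⟩ := Prod.mk.inj hz
  have h : E.map (fun z : (Σ i, T₁ i) × (Σ i, T₂ i) => z.1.1) z = E.map (fun z => z.2.1) z := by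
    have h1 := congrArg (E.map Sigma.fst) hx
    have h2 := congrArg (E.map Sigma.fst) hy
    rw [E.map_map] at h1 h2
    rw [h1, h2, x.2, y.2]
  obtain ⟨w, hw⟩ := E.mem_starSet_eq h
  let k : {z : (Σ i, T₁ i) × (Σ i, T₂ i) | z.1.1 = z.2.1} → Σ i, T₁ i × T₂ i :=
    fun z => ⟨z.1.1.1, z.1.1.2, cast (congrArg T₂ z.2.symm) z.1.2.2⟩
  have k1 : ∀ z, (⟨(k z).1, (k z).2.1⟩ : Σ i, T₁ i) = z.1.1 := fun _ => rfl
  have k2 : ∀ z, (⟨(k z).1, (k z).2.2⟩ : Σ i, T₂ i) = z.1.2 := by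
    rintro ⟨⟨⟨i, a⟩, ⟨j, b⟩⟩, h⟩
    obtain rfl : i = j := h
    rfl
  refine ⟨⟨E.map k w, ?_⟩, Subtype.ext ?_, Subtype.ext ?_⟩
  · rw [E.map_map, ← x.2, ← hx, ← hw, E.map_map, E.map_map]
  · change E.map _ (E.map k w) = _
    rw [E.map_map, ← hx, ← hw, E.map_map]
  · change E.map _ (E.map k w) = _
    rw [E.map_map, ← hy, ← hw, E.map_map]
    simp only [k2]

/-- The internal pair `(x, y)`. -/
noncomputable def pair (x : E.Internal i₀ T₁) (y : E.Internal i₀ T₂) :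
    E.Internal i₀ (fun i => T₁ i × T₂ i) :=
  (exists_pair x y).choose

theorem map_fst_pair (x : E.Internal i₀ T₁) (y : E.Internal i₀ T₂) :
    map (fun _ z => z.1) (pair x y) = x := (exists_pair x y).choose_spec.1

theorem map_snd_pair (x : E.Internal i₀ T₁) (y : E.Internal i₀ T₂) :
    map (fun _ z => z.2) (pair x y) = y := (exists_pair x y).choose_spec.2

theorem ext_pair {w w' : E.Internal i₀ (fun i => T₁ i × T₂ i)}
    (h₁ : map (fun _ z => z.1) w = map (fun _ z => z.1) w')
    (h₂ : map (fun _ z => z.2) w = map (fun _ z => z.2) w') : w = w' := by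
  let k : (Σ i, T₁ i × T₂ i) → (Σ i, T₁ i) × (Σ i, T₂ i) :=
    fun z => (⟨z.1, z.2.1⟩, ⟨z.1, z.2.2⟩)
  have hk : Function.Injective k := by
    rintro ⟨i, a, b⟩ ⟨j, c, d⟩ h
    simp only [k, Prod.mk.injEq, Sigma.mk.injEq] at h
    obtain ⟨⟨rfl, h1⟩, ⟨_, h2⟩⟩ := h
    rw [eq_of_heq h1, eq_of_heq h2]
  apply Subtype.ext
  apply E.map_injective hk
  apply (E.bijective_prod _ _).1
  simp only [E.map_map]
  exact Prod.ext (congrArg Subtype.val h₁) (congrArg Subtype.val h₂)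

theorem pair_map (f : ∀ i, T i → T₁ i) (g : ∀ i, T i → T₂ i) (w : E.Internal i₀ T) :
    pair (map f w) (map g w) = map (fun i z => (f i z, g i z)) w := by
  apply ext_pair
  · rw [map_fst_pair, map_map]
  · rw [map_snd_pair, map_map]

/-- The internal map of two variables given by a family of maps of two variables. -/
noncomputable def map₂ (f : ∀ i, T₁ i → T₂ i → T₃ i) (x : E.Internal i₀ T₁)
    (y : E.Internal i₀ T₂) : E.Internal i₀ T₃ :=
  map (fun i z => f i z.1 z.2) (pair x y)

/-- The internal statement `*R(x, y)`, where `R` is a family of relations. -/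
def Rel (R : ∀ i, T₁ i → T₂ i → Prop) (x : E.Internal i₀ T₁) (y : E.Internal i₀ T₂) : Prop :=
  Holds (fun i z => R i z.1 z.2) (pair x y)

theorem map₂_map (h : ∀ i, T₁ i → T₂ i → T₃ i) (f : ∀ i, T i → T₁ i) (g : ∀ i, T i → T₂ i)
    (w : E.Internal i₀ T) : map₂ h (map f w) (map g w) = map (fun i z => h i (f i z) (g i z)) w := by
  rw [map₂, pair_map, map_map]

theorem holds_map (P : ∀ i, T₁ i → Prop) (f : ∀ i, T i → T₁ i) (w : E.Internal i₀ T) :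
    Holds P (map f w) ↔ Holds (fun i z => P i (f i z)) w :=
  E.map_mem_starSet _ _ _

theorem rel_map (R : ∀ i, T₁ i → T₂ i → Prop) (f : ∀ i, T i → T₁ i) (g : ∀ i, T i → T₂ i)
    (w : E.Internal i₀ T) : Rel R (map f w) (map g w) ↔ Holds (fun i z => R i (f i z) (g i z)) w := by
  rw [Rel, pair_map, holds_map]

theorem Holds.mono {P Q : ∀ i, T i → Prop} {w : E.Internal i₀ T} (h : Holds P w)
    (hPQ : ∀ i z, P i z → Q i z) : Holds Q w :=
  E.starSet_mono (fun z hz => hPQ z.1 z.2 hz) h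

theorem Holds.and {P Q : ∀ i, T i → Prop} {w : E.Internal i₀ T} (h : Holds P w) (h' : Holds Q w) :
    Holds (fun i z => P i z ∧ Q i z) w :=
  E.mem_starSet_inter h h'

theorem holds_of_forall {P : ∀ i, T i → Prop} (h : ∀ i z, P i z) (w : E.Internal i₀ T) :
    Holds P w :=
  ⟨E.map (fun z => ⟨z, h z.1 z.2⟩) w.1, by rw [E.map_map]; exact E.map_id _⟩

theorem exists_map_two (x : E.Internal i₀ T₁) (y : E.Internal i₀ T₂) :
    ∃ w : E.Internal i₀ (fun i => T₁ i × T₂ i),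
      x = map (fun _ z => z.1) w ∧ y = map (fun _ z => z.2) w :=
  ⟨pair x y, (map_fst_pair x y).symm, (map_snd_pair x y).symm⟩

theorem exists_map_three (x : E.Internal i₀ T₁) (y : E.Internal i₀ T₂) (z : E.Internal i₀ T₃) :
    ∃ w : E.Internal i₀ (fun i => T₁ i × T₂ i × T₃ i),
      x = map (fun _ z => z.1) w ∧ y = map (fun _ z => z.2.1) w ∧
        z = map (fun _ z => z.2.2) w := by
  refine ⟨pair x (pair y z), (map_fst_pair _ _).symm, ?_, ?_⟩
  · have h := map_map (fun _ z => z.1) (fun _ z => z.2) (pair x (pair y z))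
    rw [map_snd_pair, map_fst_pair] at h
    exact h
  · have h := map_map (fun _ z => z.2) (fun _ z => z.2) (pair x (pair y z))
    rw [map_snd_pair, map_snd_pair] at h
    exact h

noncomputable instance [∀ i, Add (T i)] : Add (E.Internal i₀ T) := ⟨map₂ (fun _ a b => a + b)⟩
noncomputable instance [∀ i, Mul (T i)] : Mul (E.Internal i₀ T) := ⟨map₂ (fun _ a b => a * b)⟩
instance [∀ i, Neg (T i)] : Neg (E.Internal i₀ T) := ⟨map (fun _ a => -a)⟩
instance [∀ i, Zero (T i)] : Zero (E.Internal i₀ T) := ⟨const (fun _ => 0)⟩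
instance [∀ i, One (T i)] : One (E.Internal i₀ T) := ⟨const (fun _ => 1)⟩

/-- An internal ring, with its internal operations, is a commutative ring. -/
noncomputable instance [∀ i, CommRing (T i)] : CommRing (E.Internal i₀ T) where
  nsmul := nsmulRec
  zsmul := zsmulRec
  add_assoc x y z := by
    obtain ⟨w, rfl, rfl, rfl⟩ := exists_map_three x y z
    change map₂ _ (map₂ _ _ _) _ = map₂ _ _ (map₂ _ _ _)
    simp only [map₂_map, add_assoc]
  zero_add x := by
    change map₂ _ (const _) x = x
    rw [const_eq_map _ x]
    conv_lhs => rw [← map_id x, map_map, map₂_map]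
    simp only [zero_add, map_id]
  add_zero x := by
    change map₂ _ x (const _) = x
    rw [const_eq_map _ x]
    conv_lhs => rw [← map_id x, map_map, map₂_map]
    simp only [add_zero, map_id]
  add_comm x y := by
    obtain ⟨w, rfl, rfl⟩ := exists_map_two x y
    change map₂ _ _ _ = map₂ _ _ _
    simp only [map₂_map, add_comm]
  left_distrib x y z := by
    obtain ⟨w, rfl, rfl, rfl⟩ := exists_map_three x y z
    change map₂ _ _ (map₂ _ _ _) = map₂ _ (map₂ _ _ _) (map₂ _ _ _)
    simp only [map₂_map, mul_add]
  right_distrib x y z := by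
    obtain ⟨w, rfl, rfl, rfl⟩ := exists_map_three x y z
    change map₂ _ (map₂ _ _ _) _ = map₂ _ (map₂ _ _ _) (map₂ _ _ _)
    simp only [map₂_map, add_mul]
  zero_mul x := by
    change map₂ _ (const _) x = const _
    rw [const_eq_map _ x]
    conv_lhs => rw [← map_id x, map_map, map₂_map]
    simp only [zero_mul]
  mul_zero x := by
    change map₂ _ x (const _) = const _
    rw [const_eq_map _ x]
    conv_lhs => rw [← map_id x, map_map, map₂_map]
    simp only [mul_zero]
  mul_assoc x y z := by
    obtain ⟨w, rfl, rfl, rfl⟩ := exists_map_three x y z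
    change map₂ _ (map₂ _ _ _) _ = map₂ _ _ (map₂ _ _ _)
    simp only [map₂_map, mul_assoc]
  one_mul x := by
    change map₂ _ (const _) x = x
    rw [const_eq_map _ x]
    conv_lhs => rw [← map_id x, map_map, map₂_map]
    simp only [one_mul, map_id]
  mul_one x := by
    change map₂ _ x (const _) = x
    rw [const_eq_map _ x]
    conv_lhs => rw [← map_id x, map_map, map₂_map]
    simp only [mul_one, map_id]
  neg_add_cancel x := by
    change map₂ _ (map _ x) x = const _
    rw [const_eq_map _ x]
    conv_lhs => enter [3]; rw [← map_id x]
    simp only [map₂_map, neg_add_cancel]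
  mul_comm x y := by
    obtain ⟨w, rfl, rfl⟩ := exists_map_two x y
    change map₂ _ _ _ = map₂ _ _ _
    simp only [map₂_map, mul_comm]

theorem add_def [∀ i, CommRing (T i)] (x y : E.Internal i₀ T) :
    x + y = map₂ (fun _ a b => a + b) x y := rfl

theorem mul_def [∀ i, CommRing (T i)] (x y : E.Internal i₀ T) :
    x * y = map₂ (fun _ a b => a * b) x y := rfl

theorem zero_def [∀ i, CommRing (T i)] : (0 : E.Internal i₀ T) = const (fun _ => 0) := rfl

/-- An internal lattice, with its internal operations, is a lattice. -/
noncomputable instance [∀ i, Lattice (T i)] : Lattice (E.Internal i₀ T) :=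
  letI : Max (E.Internal i₀ T) := ⟨map₂ (fun _ a b => a ⊔ b)⟩
  letI : Min (E.Internal i₀ T) := ⟨map₂ (fun _ a b => a ⊓ b)⟩
  Lattice.mk'
    (fun x y => by
      obtain ⟨w, rfl, rfl⟩ := exists_map_two x y
      change map₂ _ _ _ = map₂ _ _ _
      simp only [map₂_map, sup_comm])
    (fun x y z => by
      obtain ⟨w, rfl, rfl, rfl⟩ := exists_map_three x y z
      change map₂ _ (map₂ _ _ _) _ = map₂ _ _ (map₂ _ _ _)
      simp only [map₂_map, sup_assoc])
    (fun x y => by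
      obtain ⟨w, rfl, rfl⟩ := exists_map_two x y
      change map₂ _ _ _ = map₂ _ _ _
      simp only [map₂_map, inf_comm])
    (fun x y z => by
      obtain ⟨w, rfl, rfl, rfl⟩ := exists_map_three x y z
      change map₂ _ (map₂ _ _ _) _ = map₂ _ _ (map₂ _ _ _)
      simp only [map₂_map, inf_assoc])
    (fun x y => by
      obtain ⟨w, rfl, rfl⟩ := exists_map_two x y
      change map₂ _ _ (map₂ _ _ _) = _
      simp only [map₂_map, sup_inf_self])
    (fun x y => by
      obtain ⟨w, rfl, rfl⟩ := exists_map_two x y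
      change map₂ _ _ (map₂ _ _ _) = _
      simp only [map₂_map, inf_sup_self])

end Internal

open Internal

section Rings

variable (i₀ : E.star I) (A : I → Type u) [∀ i, CommRing (A i)]

/-- The set `*Id(B)` of internal ideals of the internal ring `B = *A_{i₀}`. -/
abbrev InternalIdeal : Type v := E.Internal i₀ (fun i => Ideal (A i))

/-- The set `𝓜` of internal maximal ideals of the internal ring `B = *A_{i₀}`. -/
abbrev InternalMax : Type v := E.Internal i₀ (fun i => MaximalSpectrum (A i))

/-- The lattice `𝓛 = *P_fin(𝓜)` of hyperfinite subsets of `𝓜`, ordered by inclusion, with internal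
union and intersection as `⊔` and `⊓`. -/
abbrev HyperfiniteSets : Type v := E.Internal i₀ (fun i => Finset (MaximalSpectrum (A i)))

open Classical in
noncomputable instance : Lattice (E.HyperfiniteSets i₀ A) := inferInstance

/-- The internal product `*∏_{𝔭 ∈ 𝓜} B/𝔭`: the internal functions that send each internal maximal
ideal `𝔭` of `B` to an element of the internal residue field `B/𝔭`. -/
abbrev InternalProd : Type v :=
  E.Internal i₀ (fun i => ∀ P : MaximalSpectrum (A i), A i ⧸ P.asIdeal)

variable {E i₀ A}

/-- The internal residue field `B/𝔭` of `B` at an internal maximal ideal `𝔭`: the value at `𝔭` of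
the extension of the family `(A i / P)`, indexed by all `i` and all maximal ideals `P` of `A i`. -/
abbrev InternalResidue (p : E.InternalMax i₀ A) : Type v :=
  E.Internal p.1 (fun j : Σ i, MaximalSpectrum (A i) => A j.1 ⧸ j.2.asIdeal)

/-- The ideal of `B` (in the usual sense) that is formed by the elements of an internal ideal. -/
noncomputable def InternalIdeal.toIdeal (J : E.InternalIdeal i₀ A) : Ideal (E.Internal i₀ A) where
  carrier := {x | Rel (fun _ a K => a ∈ K) x J}
  zero_mem' := by
    rw [Set.mem_ofPred_eq, zero_def, const_eq_map _ J]
    have := (rel_map (fun i (a : A i) (K : Ideal (A i)) => a ∈ K) (fun _ _ => 0)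
      (fun _ K => K) J).2 (holds_of_forall (fun _ K => K.zero_mem) J)
    rwa [show Internal.map (fun _ K => K) J = J from Internal.map_id J] at this
  add_mem' := by
    intro x y hx hy
    obtain ⟨w, rfl, rfl, rfl⟩ := exists_map_three x y J
    simp only [Set.mem_ofPred_eq, add_def, rel_map, map₂_map] at hx hy ⊢
    exact (hx.and hy).mono (fun _ z h => z.2.2.add_mem h.1 h.2)
  smul_mem' := by
    intro c x hx
    obtain ⟨w, rfl, rfl, rfl⟩ := exists_map_three c x J
    simp only [Set.mem_ofPred_eq, smul_eq_mul, mul_def, rel_map, map₂_map] at hx ⊢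
    exact hx.mono (fun _ z h => z.2.2.mul_mem_left _ h)

/-- An ideal of `B` is internal if it is formed by the elements of an internal ideal. -/
def IsInternalIdeal (m : Ideal (E.Internal i₀ A)) : Prop :=
  ∃ J : E.InternalIdeal i₀ A, J.toIdeal = m

/-- An internal maximal ideal as an ideal of `B`. -/
noncomputable def InternalMax.toIdeal (p : E.InternalMax i₀ A) : Ideal (E.Internal i₀ A) :=
  InternalIdeal.toIdeal (Internal.map (fun _ P => P.asIdeal) p)

/-- The internal maximal ideal `p` belongs to the hyperfinite set `S`. -/
def InternalMax.MemSet (p : E.InternalMax i₀ A) (S : E.HyperfiniteSets i₀ A) : Prop :=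
  Rel (fun _ P s => P ∈ s) p S

/-- The hyperfinite set `{p}`. -/
def InternalMax.singleton (p : E.InternalMax i₀ A) : E.HyperfiniteSets i₀ A :=
  Internal.map (fun _ P => {P}) p

/-- The value `f(p) ∈ B/p` of an internal function `f ∈ *∏ B/𝔭` at an internal maximal ideal. -/
noncomputable def InternalProd.eval (f : E.InternalProd i₀ A) (p : E.InternalMax i₀ A) :
    InternalResidue p :=
  ⟨E.map (fun z : Σ i, (∀ P : MaximalSpectrum (A i), A i ⧸ P.asIdeal) × MaximalSpectrum (A i) =>
      (⟨⟨z.1, z.2.2⟩, z.2.1 z.2.2⟩ :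
        Σ j : (Σ i, MaximalSpectrum (A i)), A j.1 ⧸ j.2.asIdeal)) (pair f p).1, by
    rw [E.map_map]
    exact congrArg Subtype.val (map_snd_pair f p)⟩

/-- The diagonal map `B → *∏ B/𝔭`, which sends `b` to the internal function `𝔭 ↦ b mod 𝔭`. -/
def diag (b : E.Internal i₀ A) : E.InternalProd i₀ A :=
  Internal.map (fun _ a P => Ideal.Quotient.mk P.asIdeal a) b

/-- Two internal functions that are compared modulo `F` are identified if they agree on some
hyperfinite set in `F`; this is the ideal of those identified with `0`.  (When `F` is a nonempty
filter, the generating set is already an ideal.) -/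
noncomputable def vanishingIdeal (F : Set (E.HyperfiniteSets i₀ A)) : Ideal (E.InternalProd i₀ A) :=
  Ideal.span {f | ∃ S ∈ F, ∀ p : E.InternalMax i₀ A, p.MemSet S → f.eval p = 0}

/-- The ultraproduct `(*∏_{𝔭 ∈ 𝓜} B/𝔭) / F` (for an ultrafilter `F` on `𝓛`). -/
abbrev Ultraproduct (F : Set (E.HyperfiniteSets i₀ A)) : Type v :=
  E.InternalProd i₀ A ⧸ vanishingIdeal F

/-- The filter on `𝓛` that belongs to an ideal `m` of `B`, generated by the sets
`V(a) = {𝔭 ∈ 𝓜 | a ∈ 𝔭}` for `a ∈ m`: it consists of the hyperfinite sets that contain a finite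
intersection of such sets. -/
def filterOf (m : Ideal (E.Internal i₀ A)) : Set (E.HyperfiniteSets i₀ A) :=
  {S | ∃ t : Finset (E.Internal i₀ A), (∀ a ∈ t, a ∈ m) ∧
    ∀ p : E.InternalMax i₀ A, (∀ a ∈ t, a ∈ p.toIdeal) → p.MemSet S}

end Rings

end NonstandardExtension

/-- A filter of a lattice. -/
structure IsLatticeFilter {L : Type*} [Lattice L] (F : Set L) : Prop where
  inf_mem : ∀ a ∈ F, ∀ b ∈ F, a ⊓ b ∈ F
  sup_mem : ∀ a ∈ F, ∀ b : L, a ⊔ b ∈ F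

/-- An ultrafilter of a lattice: a maximal element among the proper filters. -/
def IsLatticeUltrafilter {L : Type*} [Lattice L] (F : Set L) : Prop :=
  Maximal (fun G : Set L => IsLatticeFilter G ∧ G ≠ Set.univ) F

/-- A filter of a lattice is principal if it has a least element. -/
def IsPrincipalFilter {L : Type*} [Lattice L] (F : Set L) : Prop :=
  ∃ a, IsLeast F a

/-! Three facts about ordinary rings are transferred to `B`. A nonzero element of a Dedekind domain
lies in only finitely many maximal ideals, so `V(a)` is hyperfinite for `a ≠ 0`
(`exists_vanishing_set_of_ne_zero`). The Chinese remainder theorem holds on hyperfinite sets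
(`exists_separating`, `exists_forall_eval_sub_diag_eq_zero`). Every proper internal ideal lies in an
internal maximal ideal.

Finitely generated ideals of `B` are internal, so finitely many elements of `m` have a common zero
in `𝓜`, even inside a given `S ∈ F`. Hence an `x` that vanishes on some `S ∈ F` lies in `m`:
otherwise `y * x + z = 1` with `z ∈ m`, and at a zero of `z` in `S` this puts `1` into a maximal
ideal.

For `T ∈ F` and hyperfinite `S`, choose `c` that is `0` on `T ∩ S` and `1` on `T \ S`. Then `c * (1
- c)` vanishes on `T`, so it lies in the prime ideal `m`; if `c ∈ m` then `S ∈ F`, and if `1 - c ∈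
m` then `T \ S ∈ F`. This dichotomy makes `F` an ultrafilter.

The diagonal map modulo `F` has kernel `m`, and it is surjective because an internal function need
only be matched on one hyperfinite `T ∈ F`. If `m` is internal it is some `p ∈ 𝓜`, and the dichotomy
for `{p}` puts `{p}` into `F`. -/

namespace NonstandardExtension

variable {E : NonstandardExtension.{u, v}} {I : Type u} {i₀ : E.star I}

/-! ### Transfer of connectives, equality and quantifiers -/

namespace Internal

variable {T T₁ T₂ T₃ : I → Type u}

theorem holds_not (P : ∀ i, T i → Prop) (w : E.Internal i₀ T) :
    Holds (fun i z => ¬ P i z) w ↔ ¬ Holds P w :=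
  ⟨fun h h' => E.notMem_starSet_compl _ _ h' h, fun h =>
    (E.mem_starSet_or {z : Σ i, T i | P z.1 z.2} w.1).resolve_left h⟩

theorem holds_and (P Q : ∀ i, T i → Prop) (w : E.Internal i₀ T) :
    Holds (fun i z => P i z ∧ Q i z) w ↔ Holds P w ∧ Holds Q w :=
  ⟨fun h => ⟨h.mono fun _ _ h => h.1, h.mono fun _ _ h => h.2⟩, fun h => h.1.and h.2⟩

theorem holds_imp (P Q : ∀ i, T i → Prop) (w : E.Internal i₀ T) :
    Holds (fun i z => P i z → Q i z) w ↔ (Holds P w → Holds Q w) := by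
  refine ⟨fun h h' => (h.and h').mono fun _ _ h => h.1 h.2, fun h => ?_⟩
  by_cases h' : Holds P w
  · exact (h h').mono fun _ _ h _ => h
  · exact ((holds_not P w).2 h').mono fun _ _ h h' => absurd h' h

theorem map_eq_map_iff (f g : ∀ i, T i → T₁ i) (w : E.Internal i₀ T) :
    map f w = map g w ↔ Holds (fun i z => f i z = g i z) w := by
  refine ⟨fun h => ?_, fun h => ?_⟩
  · refine E.starSet_mono ?_ (E.mem_starSet_eq (congrArg Subtype.val h))
    intro z hz
    exact eq_of_heq (Sigma.mk.inj hz).2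
  -- `Holds` says that `w` comes from the extension of the subset where `f` and `g` agree;
  -- restricted to that subset the two maps are literally equal.
  · obtain ⟨⟨y, hy⟩, rfl⟩ : ∃ y : {y // E.map _ (E.map _ y) = i₀},
        (⟨E.map _ y.1, y.2⟩ : E.Internal i₀ T) = w := by
      obtain ⟨y, hy⟩ := h
      exact ⟨⟨y, by rw [hy]; exact w.2⟩, Subtype.ext hy⟩
    apply Subtype.ext
    change E.map _ (E.map _ y) = E.map _ (E.map _ y)
    rw [E.map_map, E.map_map]
    congr 1
    funext z
    exact congrArg (Sigma.mk z.1.1) z.2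

/-- Choice gives a witness function on the subset where a witness exists, and its extension supplies
the internal witness. The tuple `w` is enlarged so that old and new elements are projections of one
`w'`; statements about them then reduce to a single `Holds`. -/
theorem exists_extension_of_holds {R : ∀ i, T i → T₁ i → Prop} {w : E.Internal i₀ T}
    (h : Holds (fun i z => ∃ y, R i z y) w) :
    ∃ w' : E.Internal i₀ (fun i => T i × T₁ i),
      w = map (fun _ z => z.1) w' ∧ Holds (fun i z => R i z.1 z.2) w' := by
  obtain ⟨y, hy⟩ := h
  have hc : ∀ z : {z : Σ i, T i | ∃ y, R z.1 z.2 y}, ∃ y, R z.1.1 z.1.2 y := fun z => z.2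
  choose c hc using hc
  refine ⟨⟨E.map (fun z => ⟨z.1.1, z.1.2, c z⟩) y, ?_⟩, ?_, ?_⟩
  · rw [E.map_map, ← w.2, ← hy, E.map_map]
  · apply Subtype.ext
    change _ = E.map _ (E.map _ y)
    rw [E.map_map, ← hy]
  · exact E.map_mem_starSet_of_forall _ _ hc y

theorem pair_fst_snd (w : E.Internal i₀ (fun i => T₁ i × T₂ i)) :
    pair (map (fun _ z => z.1) w) (map (fun _ z => z.2) w) = w := by
  rw [pair_map, map_id]

theorem holds_exists (R : ∀ i, T i → T₁ i → Prop) (w : E.Internal i₀ T) :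
    Holds (fun i z => ∃ y, R i z y) w ↔ ∃ y, Rel R w y := by
  refine ⟨fun h => ?_, ?_⟩
  · obtain ⟨w', rfl, h'⟩ := exists_extension_of_holds h
    exact ⟨map (fun _ z => z.2) w', by rwa [rel_map]⟩
  · rintro ⟨y, hy⟩
    obtain ⟨w, rfl, rfl⟩ := exists_map_two w y
    rw [rel_map] at hy
    rw [holds_map]
    exact hy.mono fun _ z h => ⟨z.2, h⟩

theorem rel_not (R : ∀ i, T i → T₁ i → Prop) (x : E.Internal i₀ T) (y : E.Internal i₀ T₁) :
    Rel (fun i z y => ¬ R i z y) x y ↔ ¬ Rel R x y :=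
  holds_not _ _

theorem holds_forall (R : ∀ i, T i → T₁ i → Prop) (w : E.Internal i₀ T) :
    Holds (fun i z => ∀ y, R i z y) w ↔ ∀ y, Rel R w y := by
  have h := not_congr (holds_exists (fun i z y => ¬ R i z y) w)
  rw [← holds_not] at h
  simpa only [not_exists, not_not, rel_not] using h

theorem one_def [∀ i, CommRing (T i)] : (1 : E.Internal i₀ T) = const (fun _ => 1) := rfl

theorem neg_def [∀ i, CommRing (T i)] (x : E.Internal i₀ T) :
    -x = map (fun _ a => -a) x := rfl

section mapOps

variable [∀ i, CommRing (T₁ i)] (f g : ∀ i, T i → T₁ i) (w : E.Internal i₀ T)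

theorem map_add_map : map f w + map g w = map (fun i z => f i z + g i z) w := by
  rw [add_def, map₂_map]

theorem map_mul_map : map f w * map g w = map (fun i z => f i z * g i z) w := by
  rw [mul_def, map₂_map]

theorem map_sub_map : map f w - map g w = map (fun i z => f i z - g i z) w := by
  rw [sub_eq_add_neg, neg_def, map_map, map_add_map]
  simp only [sub_eq_add_neg]

theorem zero_eq_map : (0 : E.Internal i₀ T₁) = map (fun _ _ => 0) w := const_eq_map _ _

theorem one_eq_map : (1 : E.Internal i₀ T₁) = map (fun _ _ => 1) w := const_eq_map _ _

end mapOps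

/-- The unique element of the internal one-point set. -/
def point : E.Internal i₀ (fun _ => PUnit.{u + 1}) := const (fun _ => PUnit.unit)

theorem map_point (f : ∀ i, T i → PUnit.{u + 1}) (x : E.Internal i₀ T) : map f x = point :=
  (const_eq_map (fun _ => PUnit.unit) x).symm

/-- Statements about `i₀` alone are expressed over the internal one-point set; this removes that
dummy argument once `holds_exists` has produced a witness. -/
theorem rel_point (P : ∀ i, T i → Prop) (x : E.Internal i₀ T) :
    Rel (fun i (_ : PUnit.{u + 1}) z => P i z) point x ↔ Holds P x := by
  have h := rel_map (fun i (_ : PUnit.{u + 1}) z => P i z) (fun _ _ => PUnit.unit)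
    (fun _ z => z) x
  rwa [map_id, map_point] at h

end Internal

open Internal

/-! ### Hyperfinite sets of internal maximal ideals -/

section Rings

variable {A : I → Type u} [∀ i, CommRing (A i)]

theorem InternalIdeal.mem_toIdeal {J : E.InternalIdeal i₀ A} {x : E.Internal i₀ A} :
    x ∈ J.toIdeal ↔ Rel (fun _ a K => a ∈ K) x J := Iff.rfl

theorem InternalMax.mem_toIdeal {p : E.InternalMax i₀ A} {x : E.Internal i₀ A} :
    x ∈ p.toIdeal ↔ Rel (fun _ a P => a ∈ P.asIdeal) x p := by
  obtain ⟨w, rfl, rfl⟩ := exists_map_two x p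
  rw [InternalMax.toIdeal, InternalIdeal.mem_toIdeal, Internal.map_map, rel_map, rel_map]

theorem InternalMax.memSet_singleton {p q : E.InternalMax i₀ A} :
    p.MemSet q.singleton ↔ p = q := by
  obtain ⟨w, rfl, rfl⟩ := exists_map_two p q
  rw [InternalMax.MemSet, InternalMax.singleton, Internal.map_map, rel_map, map_eq_map_iff]
  simp only [Finset.mem_singleton]

theorem InternalMax.memSet_inf {p : E.InternalMax i₀ A} {S T : E.HyperfiniteSets i₀ A} :
    p.MemSet (S ⊓ T) ↔ p.MemSet S ∧ p.MemSet T := by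
  classical
  change p.MemSet (map₂ _ S T) ↔ _
  obtain ⟨w, rfl, rfl, rfl⟩ := exists_map_three p S T
  simp only [InternalMax.MemSet, map₂_map, rel_map, ← holds_and]
  exact iff_of_eq (congrArg (Holds · w) (by funext i z; exact propext Finset.mem_inter))

theorem InternalMax.memSet_sup {p : E.InternalMax i₀ A} {S T : E.HyperfiniteSets i₀ A} :
    p.MemSet (S ⊔ T) ↔ p.MemSet S ∨ p.MemSet T := by
  classical
  change p.MemSet (map₂ _ S T) ↔ _
  obtain ⟨w, rfl, rfl, rfl⟩ := exists_map_three p S T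
  -- A disjunction is read as an implication from a negation, since both of these commute with
  -- `Holds`.
  simp only [InternalMax.MemSet, map₂_map, rel_map, or_iff_not_imp_left, ← holds_not, ← holds_imp]
  exact iff_of_eq (congrArg (Holds · w) (by
    funext i z; exact propext (Finset.mem_union.trans or_iff_not_imp_left)))

theorem HyperfiniteSets.ext {S T : E.HyperfiniteSets i₀ A}
    (h : ∀ p : E.InternalMax i₀ A, p.MemSet S ↔ p.MemSet T) : S = T := by
  obtain ⟨w, rfl, rfl⟩ := exists_map_two S T
  rw [map_eq_map_iff]
  have : Holds (fun i (z : Finset (MaximalSpectrum (A i)) × Finset (MaximalSpectrum (A i))) =>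
      ∀ P, P ∈ z.1 ↔ P ∈ z.2) w := by
    rw [holds_forall]
    intro p
    specialize h p
    obtain ⟨w', rfl, rfl⟩ := exists_map_two w p
    simp only [InternalMax.MemSet, Internal.map_map, rel_map] at h ⊢
    simp only [iff_iff_implies_and_implies, holds_and, holds_imp]
    exact ⟨h.1, h.2⟩
  exact this.mono fun _ _ h => Finset.ext h

theorem HyperfiniteSets.le_iff {S T : E.HyperfiniteSets i₀ A} :
    S ≤ T ↔ ∀ p : E.InternalMax i₀ A, p.MemSet S → p.MemSet T := by
  rw [← sup_eq_right]
  refine ⟨fun h p hp => h ▸ InternalMax.memSet_sup.2 (Or.inl hp), fun h => HyperfiniteSets.ext ?_⟩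
  intro p
  rw [InternalMax.memSet_sup]
  exact or_iff_right_of_imp (h p)

theorem HyperfiniteSets.exists_diff (S T : E.HyperfiniteSets i₀ A) :
    ∃ D : E.HyperfiniteSets i₀ A, ∀ p : E.InternalMax i₀ A,
      p.MemSet D ↔ p.MemSet S ∧ ¬ p.MemSet T := by
  classical
  refine ⟨map₂ (fun _ s t => s \ t) S T, fun p => ?_⟩
  obtain ⟨w, rfl, rfl, rfl⟩ := exists_map_three p S T
  simp only [InternalMax.MemSet, map₂_map, rel_map, ← holds_not, ← holds_and, Finset.mem_sdiff]

variable (E i₀ A) in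
theorem HyperfiniteSets.exists_empty :
    ∃ S : E.HyperfiniteSets i₀ A, ∀ p : E.InternalMax i₀ A, ¬ p.MemSet S := by
  -- Any set minus itself has no members; the choice of `∅` plays no role.
  obtain ⟨D, hD⟩ := HyperfiniteSets.exists_diff (const fun _ => ∅ : E.HyperfiniteSets i₀ A)
    (const fun _ => ∅)
  exact ⟨D, fun p hp => ((hD p).1 hp).2 ((hD p).1 hp).1⟩

/-! ### Internal ideals and common zeros -/

/-- An internal ideal and an element generate an internal ideal. -/
theorem InternalIdeal.exists_adjoin (J : E.InternalIdeal i₀ A) (a : E.Internal i₀ A) :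
    ∃ J' : E.InternalIdeal i₀ A, J'.toIdeal = J.toIdeal ⊔ Ideal.span {a} := by
  refine ⟨map₂ (fun _ K a => K ⊔ Ideal.span {a}) J a, ?_⟩
  apply le_antisymm
  · intro x hx
    rw [InternalIdeal.mem_toIdeal] at hx
    obtain ⟨w, rfl, rfl, rfl⟩ := exists_map_three x J a
    rw [map₂_map, rel_map] at hx
    -- Membership in `K ⊔ (a)` becomes the existence of a coefficient `r` with `x - r * a ∈ K`; its
    -- internal witness gives a decomposition in `B` itself.
    have hx' : Holds (fun i (z : A i × Ideal (A i) × A i) =>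
        ∃ r : A i, z.1 - r * z.2.2 ∈ z.2.1) w := by
      refine hx.mono fun i z h => ?_
      obtain ⟨y, hy, b, hb, hyb⟩ := Submodule.mem_sup.1 h
      obtain ⟨r, rfl⟩ := Ideal.mem_span_singleton'.1 hb
      exact ⟨r, by rwa [← hyb, add_sub_cancel_right]⟩
    obtain ⟨w', rfl, hw'⟩ := exists_extension_of_holds hx'
    simp only [Internal.map_map]
    have key : Internal.map (fun _ z => z.1.1) w' - Internal.map (fun _ z => z.2) w' *
        Internal.map (fun _ z => z.1.2.2) w' ∈
          InternalIdeal.toIdeal (Internal.map (fun _ z => z.1.2.1) w') := by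
      rw [map_mul_map, map_sub_map, InternalIdeal.mem_toIdeal, rel_map]
      exact hw'
    exact Submodule.mem_sup.2 ⟨_, key, _, Ideal.mul_mem_left _ _ (Ideal.mem_span_singleton_self _),
      sub_add_cancel _ _⟩
  · rw [sup_le_iff, Ideal.span_singleton_le_iff_mem]
    constructor
    · intro x hx
      rw [InternalIdeal.mem_toIdeal] at hx ⊢
      obtain ⟨w, rfl, rfl, rfl⟩ := exists_map_three x J a
      rw [rel_map] at hx
      rw [map₂_map, rel_map]
      exact hx.mono fun _ z h => Ideal.mem_sup_left h
    · rw [InternalIdeal.mem_toIdeal]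
      obtain ⟨w, rfl, rfl⟩ := exists_map_two J a
      rw [map₂_map, rel_map]
      exact holds_of_forall (fun _ z => Ideal.mem_sup_right (Ideal.mem_span_singleton_self _)) w

/-- The induction is over a genuinely finite set, adjoining one generator at a time. -/
theorem InternalIdeal.exists_toIdeal_eq_span (t : Finset (E.Internal i₀ A)) :
    ∃ J : E.InternalIdeal i₀ A, J.toIdeal = Ideal.span (t : Set (E.Internal i₀ A)) := by
  classical
  induction t using Finset.induction_on with
  | empty =>
    refine ⟨const fun _ => ⊥, ?_⟩
    rw [Finset.coe_empty, Ideal.span_empty, eq_bot_iff]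
    intro x hx
    rw [InternalIdeal.mem_toIdeal, const_eq_map _ x] at hx
    have h := (rel_map (fun _ a K => a ∈ K) (fun _ z => z) (fun i _ => (⊥ : Ideal (A i))) x).1
      (by rwa [Internal.map_id])
    rw [Ideal.mem_bot, zero_eq_map x, ← Internal.map_id x, Internal.map_map, map_eq_map_iff]
    exact h.mono fun _ _ h => h
  | insert a t _ ih =>
    obtain ⟨J, hJ⟩ := ih
    obtain ⟨J', hJ'⟩ := J.exists_adjoin a
    exact ⟨J', by rw [hJ', hJ, Finset.coe_insert, Ideal.span_insert, sup_comm]⟩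

theorem InternalIdeal.exists_le_internalMax {J : E.InternalIdeal i₀ A} (hJ : J.toIdeal ≠ ⊤) :
    ∃ p : E.InternalMax i₀ A, J.toIdeal ≤ p.toIdeal := by
  -- Properness means the same internally and externally, because both are detected by `1`. Krull's
  -- theorem can then be applied in each `A i`.
  have h1 : Holds (fun _ K => K ≠ ⊤) J := by
    rw [holds_not]
    intro h
    apply hJ
    rw [Ideal.eq_top_iff_one, InternalIdeal.mem_toIdeal, one_eq_map J]
    have := (rel_map (fun _ a K => a ∈ K) (fun i _ => (1 : A i)) (fun _ K => K) J).2
      (h.mono fun _ K hK => by rw [hK]; trivial)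
    rwa [Internal.map_id] at this
  have h2 : Holds (fun i (K : Ideal (A i)) => ∃ P : MaximalSpectrum (A i), K ≤ P.asIdeal) J :=
    h1.mono fun i K hK => by
      obtain ⟨M, hM, hKM⟩ := Ideal.exists_le_maximal K hK
      exact ⟨⟨M, hM⟩, hKM⟩
  obtain ⟨p, hp⟩ := (holds_exists _ _).1 h2
  refine ⟨p, fun x hx => ?_⟩
  rw [InternalMax.mem_toIdeal]
  rw [InternalIdeal.mem_toIdeal] at hx
  obtain ⟨w, rfl, rfl, rfl⟩ := exists_map_three x J p
  rw [rel_map] at hx hp ⊢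
  exact (hx.and hp).mono fun _ z h => h.2 h.1

theorem InternalMax.one_notMem (p : E.InternalMax i₀ A) : 1 ∉ p.toIdeal := by
  intro h
  rw [InternalMax.mem_toIdeal, one_eq_map p] at h
  have h' := (rel_map (fun _ a P => a ∈ P.asIdeal) (fun i _ => (1 : A i)) (fun _ P => P) p).1
    (by rwa [Internal.map_id])
  exact (holds_not _ _).1 (holds_of_forall
    (fun i (P : MaximalSpectrum (A i)) => (Ideal.ne_top_iff_one _).1 P.isMaximal.ne_top) p) h'

theorem InternalMax.toIdeal_ne_top (p : E.InternalMax i₀ A) : p.toIdeal ≠ ⊤ :=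
  (Ideal.ne_top_iff_one _).2 p.one_notMem

/-- Finitely many elements of a proper ideal have a common internal maximal ideal. -/
theorem exists_internalMax_of_finset_subset {m : Ideal (E.Internal i₀ A)} (hm : m ≠ ⊤)
    (t : Finset (E.Internal i₀ A)) (ht : ∀ a ∈ t, a ∈ m) :
    ∃ p : E.InternalMax i₀ A, ∀ a ∈ t, a ∈ p.toIdeal := by
  obtain ⟨J, hJ⟩ := InternalIdeal.exists_toIdeal_eq_span t
  have hle : J.toIdeal ≤ m := hJ.le.trans (Ideal.span_le.2 ht)
  obtain ⟨p, hp⟩ := InternalIdeal.exists_le_internalMax (ne_top_of_le_ne_top hm hle)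
  exact ⟨p, fun a ha => hp (hJ.ge (Ideal.subset_span ha))⟩

/-! ### Chinese remainders and hyperfinite vanishing sets -/

/-- The Chinese remainder theorem for finitely many maximal ideals. -/
theorem exists_forall_mk_eq_of_finset {R : Type*} [CommRing R] (s : Finset (MaximalSpectrum R))
    (f : ∀ P : MaximalSpectrum R, R ⧸ P.asIdeal) :
    ∃ r : R, ∀ P ∈ s, f P = Ideal.Quotient.mk P.asIdeal r := by
  obtain ⟨r, hr⟩ := Ideal.pi_quotient_surjective (I := fun P : s => P.1.asIdeal)
    (fun P Q h => Ideal.isCoprime_of_isMaximal (fun h' => h (Subtype.ext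
      (MaximalSpectrum.ext h')))) (fun P => f P.1)
  exact ⟨r, fun P hP => (hr ⟨P, hP⟩).symm⟩

/-- The internal Chinese remainder theorem: an element that lies in the members of `S` and is
congruent to `1` modulo the members of `T` outside `S`. -/
theorem exists_separating (S T : E.HyperfiniteSets i₀ A) :
    ∃ c : E.Internal i₀ A, ∀ p : E.InternalMax i₀ A, p.MemSet T →
      (p.MemSet S → c ∈ p.toIdeal) ∧ (¬ p.MemSet S → 1 - c ∈ p.toIdeal) := by
  classical
  obtain ⟨w, rfl, rfl⟩ := exists_map_two S T
  have h : Holds (fun i (z : Finset (MaximalSpectrum (A i)) × Finset (MaximalSpectrum (A i))) =>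
      ∃ c : A i, ∀ P ∈ z.2, (P ∈ z.1 → c ∈ P.asIdeal) ∧ (P ∉ z.1 → 1 - c ∈ P.asIdeal)) w := by
    refine holds_of_forall (fun i z => ?_) w
    obtain ⟨r, hr⟩ := exists_forall_mk_eq_of_finset z.2 (fun P => if P ∈ z.1 then 0 else 1)
    refine ⟨r, fun P hP => ⟨fun h => ?_, fun h => ?_⟩⟩
    · have := hr P hP
      rw [if_pos h] at this
      exact Ideal.Quotient.eq_zero_iff_mem.1 this.symm
    · have := hr P hP
      rw [if_neg h, ← map_one (Ideal.Quotient.mk P.asIdeal)] at this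
      exact (Ideal.Quotient.mk_eq_mk_iff_sub_mem _ _).1 this
  replace h := exists_extension_of_holds h
  obtain ⟨w, rfl, h⟩ := h
  refine ⟨Internal.map (fun _ z => z.2) w, fun p => ?_⟩
  rw [holds_forall] at h
  specialize h p
  obtain ⟨w, rfl, rfl⟩ := exists_map_two w p
  simp only [InternalMax.mem_toIdeal, InternalMax.MemSet, Internal.map_map, one_eq_map w,
    map_sub_map, rel_map, ← holds_not, ← holds_imp, ← holds_and] at h ⊢
  exact h

/-- In a Dedekind domain a maximal ideal containing `x` divides `(x)`, and a nonzero ideal has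
finitely many divisors. -/
theorem exists_vanishing_set_of_ne_zero [∀ i, IsDedekindDomain (A i)] {a : E.Internal i₀ A}
    (ha : a ≠ 0) :
    ∃ S : E.HyperfiniteSets i₀ A, ∀ p : E.InternalMax i₀ A, p.MemSet S ↔ a ∈ p.toIdeal := by
  have h1 : Holds (fun _ x => x ≠ 0) a := by
    rw [holds_not]
    intro h
    apply ha
    rw [zero_eq_map a, ← Internal.map_id a, Internal.map_map, map_eq_map_iff]
    exact h
  have h2 : Holds (fun i (x : A i) => ∃ s : Finset (MaximalSpectrum (A i)),
      ∀ P, P ∈ s ↔ x ∈ P.asIdeal) a := by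
    refine h1.mono fun i x hx => ?_
    have hfin : {P : MaximalSpectrum (A i) | x ∈ P.asIdeal}.Finite := by
      have hI : Ideal.span {x} ≠ ⊥ := by rwa [Ne, Ideal.span_singleton_eq_bot]
      have := UniqueFactorizationMonoid.fintypeSubtypeDvd (Ideal.span {x}) hI
      have hd : {J : Ideal (A i) | J ∣ Ideal.span {x}}.Finite :=
        Set.finite_coe_iff.1 (inferInstanceAs (Finite {J : Ideal (A i) // J ∣ Ideal.span {x}}))
      refine Set.Finite.of_finite_image (f := MaximalSpectrum.asIdeal) (hd.subset ?_) ?_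
      · rintro _ ⟨P, hP, rfl⟩
        exact Ideal.dvd_span_singleton.2 hP
      · exact fun P _ Q _ h => MaximalSpectrum.ext h
    exact ⟨hfin.toFinset, fun P => by simp⟩
  obtain ⟨S, hS⟩ := (holds_exists _ _).1 h2
  refine ⟨S, fun p => ?_⟩
  obtain ⟨w, rfl, rfl⟩ := exists_map_two a S
  rw [rel_map, holds_forall] at hS
  specialize hS p
  obtain ⟨w, rfl, rfl⟩ := exists_map_two w p
  simp only [InternalMax.mem_toIdeal, InternalMax.MemSet, Internal.map_map, rel_map,
    iff_iff_implies_and_implies, ← holds_imp, ← holds_and] at hS ⊢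
  exact hS

variable (E i₀ A) in
/-- Either `𝓜` is hyperfinite, or `B` has a nonzero nonunit. -/
theorem exists_forall_memSet_or_exists_ne_zero_not_isUnit [∀ i, IsDedekindDomain (A i)] :
    (∃ S : E.HyperfiniteSets i₀ A, ∀ p : E.InternalMax i₀ A, p.MemSet S) ∨
      ∃ a : E.Internal i₀ A, a ≠ 0 ∧ ¬ IsUnit a := by
  let w : E.Internal i₀ (fun _ => PUnit.{u + 1}) := point
  by_cases h : Holds (fun i (_ : PUnit.{u + 1}) => IsField (A i)) w
  · left
    have h' : Holds (fun i (_ : PUnit.{u + 1}) => ∃ s : Finset (MaximalSpectrum (A i)),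
        ∀ P, P ∈ s) w := by
      refine h.mono fun i _ hi => ?_
      let _ := hi.toField
      -- The zero ideal is the only maximal ideal of a field.
      refine ⟨{⟨⊥, Ideal.bot_isMaximal⟩}, fun P => ?_⟩
      rw [Finset.mem_singleton]
      exact MaximalSpectrum.ext
        ((Ideal.eq_bot_or_top P.asIdeal).resolve_right P.isMaximal.ne_top)
    obtain ⟨S, hS⟩ := (holds_exists _ _).1 h'
    refine ⟨S, fun p => ?_⟩
    rw [rel_point (fun i (s : Finset (MaximalSpectrum (A i))) => ∀ P, P ∈ s), holds_forall] at hS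
    specialize hS p
    obtain ⟨w, rfl, rfl⟩ := exists_map_two S p
    rw [rel_map] at hS
    rwa [InternalMax.MemSet, rel_map]
  · right
    rw [← holds_not] at h
    have h' : Holds (fun i (_ : PUnit.{u + 1}) => ∃ a : A i, a ≠ 0 ∧ ∀ b, a * b ≠ 1) w := by
      refine h.mono fun i _ hi => ?_
      by_contra! hc
      exact hi ⟨exists_pair_ne _, mul_comm, fun {a} ha => hc a ha⟩
    obtain ⟨a, ha⟩ := (holds_exists _ _).1 h'
    rw [rel_point (fun i (a : A i) => a ≠ 0 ∧ ∀ b, a * b ≠ 1), holds_and, holds_not,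
      holds_forall] at ha
    refine ⟨a, fun h0 => ha.1 ?_, fun hu => ?_⟩
    · rw [zero_eq_map a, ← Internal.map_id a, Internal.map_map, map_eq_map_iff] at h0
      exact h0
    · obtain ⟨b, hb⟩ := hu.exists_right_inv
      have := ha.2 b
      obtain ⟨w, rfl, rfl⟩ := exists_map_two a b
      rw [one_eq_map w, map_mul_map, map_eq_map_iff] at hb
      rw [rel_map, holds_not] at this
      exact this hb

/-! ### Evaluation of internal functions and the diagonal map -/

/-- An internal element, reindexed over the pairs of an index and a maximal ideal. -/
noncomputable def Internal.atMax {T : I → Type u} (q : E.Internal i₀ T) (p : E.InternalMax i₀ A) :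
    E.Internal p.1 (fun j : Σ i, MaximalSpectrum (A i) => T j.1) :=
  ⟨E.map (fun z : Σ i, T i × MaximalSpectrum (A i) =>
      (⟨⟨z.1, z.2.2⟩, z.2.1⟩ : Σ j : (Σ i, MaximalSpectrum (A i)), T j.1)) (pair q p).1, by
    rw [E.map_map]
    exact congrArg Subtype.val (map_snd_pair q p)⟩

/-- Functions live over `i₀`, their values over `p.1`. Evaluation becomes an ordinary internal map
over the pairs `(i, P)`, so ring identities for values follow from pointwise ones. -/
theorem InternalProd.eval_map {T : I → Type u}
    (φ : ∀ i, T i → ∀ P : MaximalSpectrum (A i), A i ⧸ P.asIdeal) (q : E.Internal i₀ T)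
    (p : E.InternalMax i₀ A) :
    InternalProd.eval (Internal.map φ q) p =
      Internal.map (fun j (z : T j.1) => φ j.1 z j.2) (q.atMax p) := by
  apply Subtype.ext
  change E.map _ _ = E.map _ (E.map _ _)
  have h : pair (Internal.map φ q) p =
      Internal.map (fun i (z : T i × MaximalSpectrum (A i)) => (φ i z.1, z.2)) (pair q p) := by
    obtain ⟨w, rfl, rfl⟩ := exists_map_two q p
    rw [pair_fst_snd, Internal.map_map, pair_map]
  rw [h]
  change E.map _ (E.map _ _) = _
  rw [E.map_map, E.map_map]

theorem InternalProd.eval_add (f g : E.InternalProd i₀ A) (p : E.InternalMax i₀ A) :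
    (f + g).eval p = f.eval p + g.eval p := by
  obtain ⟨w, rfl, rfl⟩ := exists_map_two f g
  rw [map_add_map, InternalProd.eval_map, InternalProd.eval_map, InternalProd.eval_map,
    map_add_map]
  rfl

theorem InternalProd.eval_mul (f g : E.InternalProd i₀ A) (p : E.InternalMax i₀ A) :
    (f * g).eval p = f.eval p * g.eval p := by
  obtain ⟨w, rfl, rfl⟩ := exists_map_two f g
  rw [map_mul_map, InternalProd.eval_map, InternalProd.eval_map, InternalProd.eval_map,
    map_mul_map]
  rfl

theorem InternalProd.eval_zero (p : E.InternalMax i₀ A) :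
    InternalProd.eval (0 : E.InternalProd i₀ A) p = 0 := by
  rw [zero_eq_map p, InternalProd.eval_map, zero_eq_map (p.atMax p)]
  rfl

theorem InternalProd.eval_one (p : E.InternalMax i₀ A) :
    InternalProd.eval (1 : E.InternalProd i₀ A) p = 1 := by
  rw [one_eq_map p, InternalProd.eval_map, one_eq_map (p.atMax p)]
  rfl

/-- Evaluation at an internal maximal ideal, as a ring homomorphism. -/
noncomputable def InternalProd.evalHom (p : E.InternalMax i₀ A) :
    E.InternalProd i₀ A →+* InternalResidue p where
  toFun f := f.eval p
  map_one' := InternalProd.eval_one p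
  map_mul' f g := InternalProd.eval_mul f g p
  map_zero' := InternalProd.eval_zero p
  map_add' f g := InternalProd.eval_add f g p

/-- Brings vanishing of a value back to a relation over `i₀`, where transferred statements apply. -/
theorem InternalProd.eval_eq_zero_iff (f : E.InternalProd i₀ A) (p : E.InternalMax i₀ A) :
    f.eval p = 0 ↔ Rel (fun _ f P => f P = 0) f p := by
  have h := InternalProd.eval_map (fun _ f => f) f p
  rw [Internal.map_id] at h
  rw [h, zero_eq_map (f.atMax p), map_eq_map_iff]
  exact E.map_mem_starSet _ _ _

theorem InternalProd.evalHom_surjective (p : E.InternalMax i₀ A) :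
    Function.Surjective (InternalProd.evalHom p) := by
  classical
  rintro ⟨r, hr⟩
  let k : (Σ j : (Σ i, MaximalSpectrum (A i)), A j.1 ⧸ j.2.asIdeal) →
      Σ i, (∀ P : MaximalSpectrum (A i), A i ⧸ P.asIdeal) × MaximalSpectrum (A i) :=
    -- A residue class at `P` is extended by `0` to all other maximal ideals.
    fun z => ⟨z.1.1, Function.update 0 z.1.2 z.2, z.1.2⟩
  let w : E.Internal i₀ (fun i =>
      (∀ P : MaximalSpectrum (A i), A i ⧸ P.asIdeal) × MaximalSpectrum (A i)) :=
    ⟨E.map k r, by rw [E.map_map, ← p.2, ← hr, E.map_map]⟩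
  have hp : p = Internal.map (fun _ z => z.2) w := by
    apply Subtype.ext
    change p.1 = E.map _ (E.map k r)
    rw [E.map_map, ← hr]
  refine ⟨Internal.map (fun _ z => z.1) w, Subtype.ext ?_⟩
  change E.map _ (pair _ p).1 = r
  have hw : pair (Internal.map (fun _ z => z.1) w) p = w := by
    conv_lhs => rw [hp]
    exact pair_fst_snd w
  rw [hw]
  change E.map _ (E.map k r) = r
  rw [E.map_map]
  refine Eq.trans ?_ (E.map_id r)
  congr 1
  funext z
  simp [k]

/-- The diagonal map, as a ring homomorphism. -/
noncomputable def diagHom : E.Internal i₀ A →+* E.InternalProd i₀ A where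
  toFun := diag
  map_one' := by
    rw [one_def, one_def, diag, Internal.map_const]
    rfl
  map_mul' x y := by
    obtain ⟨w, rfl, rfl⟩ := exists_map_two x y
    simp only [diag, map_mul_map, Internal.map_map, map_mul]
    rfl
  map_zero' := by
    rw [zero_def, zero_def, diag, Internal.map_const]
    rfl
  map_add' x y := by
    obtain ⟨w, rfl, rfl⟩ := exists_map_two x y
    simp only [diag, map_add_map, Internal.map_map, map_add]
    rfl

theorem eval_diag_eq_zero_iff (b : E.Internal i₀ A) (p : E.InternalMax i₀ A) :
    (diag b).eval p = 0 ↔ b ∈ p.toIdeal := by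
  rw [InternalProd.eval_eq_zero_iff, InternalMax.mem_toIdeal]
  obtain ⟨w, rfl, rfl⟩ := exists_map_two b p
  rw [diag, Internal.map_map, rel_map, rel_map]
  simp only [Ideal.Quotient.eq_zero_iff_mem]

/-- The internal Chinese remainder theorem: an internal function agrees on a hyperfinite set with
an element of `B`. -/
theorem exists_forall_eval_sub_diag_eq_zero (f : E.InternalProd i₀ A)
    (S : E.HyperfiniteSets i₀ A) :
    ∃ b : E.Internal i₀ A, ∀ p : E.InternalMax i₀ A, p.MemSet S → (f - diag b).eval p = 0 := by
  obtain ⟨w, rfl, rfl⟩ := exists_map_two f S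
  have h : Holds (fun i (z : (∀ P : MaximalSpectrum (A i), A i ⧸ P.asIdeal) ×
      Finset (MaximalSpectrum (A i))) =>
      ∃ b : A i, ∀ P, P ∈ z.2 → z.1 P = Ideal.Quotient.mk P.asIdeal b) w :=
    holds_of_forall (fun i z => exists_forall_mk_eq_of_finset z.2 z.1) w
  replace h := exists_extension_of_holds h
  obtain ⟨w, rfl, h⟩ := h
  refine ⟨Internal.map (fun _ z => z.2) w, fun p => ?_⟩
  rw [holds_forall] at h
  specialize h p
  obtain ⟨w, rfl, rfl⟩ := exists_map_two w p
  simp only [InternalProd.eval_eq_zero_iff, InternalMax.MemSet, Internal.map_map, diag,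
    map_sub_map, rel_map, ← holds_imp, Pi.sub_apply, sub_eq_zero] at h ⊢
  exact h

/-! ### The filter of a maximal ideal -/

variable {m : Ideal (E.Internal i₀ A)}

theorem isLatticeFilter_filterOf (m : Ideal (E.Internal i₀ A)) :
    IsLatticeFilter (filterOf m) where
  inf_mem := by
    classical
    rintro S ⟨s, hs, hS⟩ T ⟨t, ht, hT⟩
    refine ⟨s ∪ t, fun a ha => (Finset.mem_union.1 ha).elim (hs a) (ht a), fun p hp => ?_⟩
    exact InternalMax.memSet_inf.2 ⟨hS p fun a ha => hp a (Finset.mem_union_left _ ha),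
      hT p fun a ha => hp a (Finset.mem_union_right _ ha)⟩
  sup_mem := by
    rintro S ⟨s, hs, hS⟩ T
    exact ⟨s, hs, fun p hp => InternalMax.memSet_sup.2 (Or.inl (hS p hp))⟩

/-- `S` contains the common zeros of a finite subset of `m`, and adjoining `a` to that subset keeps
it finite and inside `m`. -/
theorem exists_memSet_of_mem_filterOf (hm : m ≠ ⊤) {S : E.HyperfiniteSets i₀ A}
    (hS : S ∈ filterOf m) {a : E.Internal i₀ A} (ha : a ∈ m) :
    ∃ p : E.InternalMax i₀ A, p.MemSet S ∧ a ∈ p.toIdeal := by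
  classical
  obtain ⟨t, ht, hS⟩ := hS
  obtain ⟨p, hp⟩ := exists_internalMax_of_finset_subset hm (insert a t) (by
    simpa [ha] using ht)
  exact ⟨p, hS p fun b hb => hp b (Finset.mem_insert_of_mem hb), hp a (Finset.mem_insert_self _ _)⟩

/-- If `x ∉ m`, then `y * x + z = 1` with `z ∈ m`; at a zero of `z` in `S` both summands vanish. -/
theorem mem_of_forall_memSet (hm : m.IsMaximal) {S : E.HyperfiniteSets i₀ A}
    (hS : S ∈ filterOf m) {x : E.Internal i₀ A}
    (hx : ∀ p : E.InternalMax i₀ A, p.MemSet S → x ∈ p.toIdeal) : x ∈ m := by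
  by_contra hxm
  obtain ⟨y, z, hz, hyz⟩ := hm.exists_inv hxm
  obtain ⟨p, hpS, hzp⟩ := exists_memSet_of_mem_filterOf hm.ne_top hS hz
  exact p.one_notMem (hyz ▸ add_mem (Ideal.mul_mem_left _ _ (hx p hpS)) hzp)

/-- A hyperfinite set that contains all common zeros in `T ∈ F` of an element of `m`. -/
theorem mem_filterOf_of_forall_memSet {T : E.HyperfiniteSets i₀ A} (hT : T ∈ filterOf m)
    {c : E.Internal i₀ A} (hc : c ∈ m) {S : E.HyperfiniteSets i₀ A}
    (hS : ∀ p : E.InternalMax i₀ A, p.MemSet T → c ∈ p.toIdeal → p.MemSet S) :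
    S ∈ filterOf m := by
  classical
  obtain ⟨t, ht, hT⟩ := hT
  refine ⟨insert c t, by simpa [hc] using ht, fun p hp => ?_⟩
  exact hS p (hT p fun a ha => hp a (Finset.mem_insert_of_mem ha))
    (hp c (Finset.mem_insert_self _ _))

/-- An ultrafilter decides membership of every hyperfinite set, relative to a member. -/
theorem mem_filterOf_or_diff_mem (hm : m.IsMaximal) {S T D : E.HyperfiniteSets i₀ A}
    (hT : T ∈ filterOf m)
    (hD : ∀ p : E.InternalMax i₀ A, p.MemSet D ↔ p.MemSet T ∧ ¬ p.MemSet S) :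
    S ∈ filterOf m ∨ D ∈ filterOf m := by
  obtain ⟨c, hc⟩ := exists_separating S T
  -- On `T` the element `c` is `0` or `1` modulo each `p`, so the product vanishes on `T`, and
  -- primality of `m` selects a factor.
  have h : c * (1 - c) ∈ m := mem_of_forall_memSet hm hT fun p hp => by
    by_cases hpS : p.MemSet S
    · exact Ideal.mul_mem_right _ _ ((hc p hp).1 hpS)
    · exact Ideal.mul_mem_left _ _ ((hc p hp).2 hpS)
  have hone : ∀ p : E.InternalMax i₀ A, c ∈ p.toIdeal → 1 - c ∉ p.toIdeal := fun p h h' =>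
    p.one_notMem (add_sub_cancel c 1 ▸ add_mem h h')
  refine (hm.isPrime.mem_or_mem h).imp (fun h => ?_) (fun h => ?_)
  · refine mem_filterOf_of_forall_memSet hT h fun p hpT hpc => ?_
    by_contra hpS
    exact hone p hpc ((hc p hpT).2 hpS)
  · refine mem_filterOf_of_forall_memSet hT h fun p hpT hpc => (hD p).2 ⟨hpT, fun hpS => ?_⟩
    exact hone p ((hc p hpT).1 hpS) hpc

theorem exists_mem_vanishing_of_mem_vanishingIdeal {F : Set (E.HyperfiniteSets i₀ A)}
    (hF : IsLatticeFilter F) (hne : F.Nonempty) {f : E.InternalProd i₀ A}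
    (hf : f ∈ vanishingIdeal F) :
    ∃ S ∈ F, ∀ p : E.InternalMax i₀ A, p.MemSet S → f.eval p = 0 := by
  induction hf using Submodule.span_induction with
  | mem f hf => exact hf
  | zero =>
    obtain ⟨S, hS⟩ := hne
    exact ⟨S, hS, fun p _ => InternalProd.eval_zero p⟩
  | add f g _ _ hf hg =>
    obtain ⟨S, hS, hfS⟩ := hf
    obtain ⟨T, hT, hgT⟩ := hg
    refine ⟨S ⊓ T, hF.inf_mem S hS T hT, fun p hp => ?_⟩
    rw [InternalMax.memSet_inf] at hp
    rw [InternalProd.eval_add, hfS p hp.1, hgT p hp.2, add_zero]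
  | smul g f _ hf =>
    obtain ⟨S, hS, hfS⟩ := hf
    refine ⟨S, hS, fun p hp => ?_⟩
    rw [smul_eq_mul, InternalProd.eval_mul, hfS p hp, mul_zero]

theorem mem_vanishingIdeal {F : Set (E.HyperfiniteSets i₀ A)} {f : E.InternalProd i₀ A}
    {S : E.HyperfiniteSets i₀ A} (hS : S ∈ F)
    (hf : ∀ p : E.InternalMax i₀ A, p.MemSet S → f.eval p = 0) : f ∈ vanishingIdeal F :=
  Ideal.subset_span ⟨S, hS, hf⟩

/-! ### Ultrafilter, residue ring and the internal case -/

section Dedekind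

variable [∀ i, IsDedekindDomain (A i)]

theorem exists_vanishing_set_mem_filterOf {a : E.Internal i₀ A} (ha : a ≠ 0) (ham : a ∈ m) :
    ∃ S ∈ filterOf m, ∀ p : E.InternalMax i₀ A, p.MemSet S ↔ a ∈ p.toIdeal := by
  obtain ⟨S, hS⟩ := exists_vanishing_set_of_ne_zero ha
  exact ⟨S, ⟨{a}, by simpa using ham, fun p hp =>
    (hS p).2 (hp a (Finset.mem_singleton_self a))⟩, hS⟩

/-- Not automatic, since `V(0) = 𝓜` need not be hyperfinite. Unless it is, a nonzero element of `m`
is needed. -/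
theorem filterOf_nonempty (hm : m.IsMaximal) : (filterOf m).Nonempty := by
  rcases exists_forall_memSet_or_exists_ne_zero_not_isUnit E i₀ A with ⟨S, hS⟩ | ⟨a, ha, hu⟩
  · exact ⟨S, ∅, by simp, fun p _ => hS p⟩
  · by_cases ham : a ∈ m
    · obtain ⟨S, hS, _⟩ := exists_vanishing_set_mem_filterOf ha ham
      exact ⟨S, hS⟩
    -- Here `z ∈ m` serves instead of `a`: `z = 0` would make `a` a unit.
    · obtain ⟨y, z, hz, hyz⟩ := hm.exists_inv ham
      have hz0 : z ≠ 0 := by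
        rintro rfl
        rw [add_zero] at hyz
        exact hu (IsUnit.of_mul_eq_one_right _ hyz)
      obtain ⟨S, hS, _⟩ := exists_vanishing_set_mem_filterOf hz0 hz
      exact ⟨S, hS⟩

theorem isLatticeUltrafilter_filterOf (hm : m.IsMaximal) :
    IsLatticeUltrafilter (filterOf m) := by
  obtain ⟨N, hN⟩ := HyperfiniteSets.exists_empty E i₀ A
  refine ⟨⟨isLatticeFilter_filterOf m, fun h => ?_⟩, ?_⟩
  · have hNm : N ∈ filterOf m := h ▸ Set.mem_univ N
    obtain ⟨p, hp, _⟩ := exists_memSet_of_mem_filterOf hm.ne_top hNm m.zero_mem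
    exact hN p hp
  · rintro G ⟨hG, hGne⟩ hle S hS
    obtain ⟨T, hT⟩ := filterOf_nonempty hm
    obtain ⟨D, hD⟩ := HyperfiniteSets.exists_diff T S
    -- If `D = T \ S` were in `F ⊆ G`, then `G` would contain the empty set `S ⊓ D` and hence
    -- everything.
    refine (mem_filterOf_or_diff_mem hm hT hD).resolve_right fun hDm => hGne ?_
    refine Set.eq_univ_of_forall fun X => ?_
    have h := hG.sup_mem _ (hG.inf_mem _ hS _ (hle hDm)) X
    have hle' : S ⊓ D ≤ X := HyperfiniteSets.le_iff.2 fun p hp => by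
      rw [InternalMax.memSet_inf, hD] at hp
      exact absurd hp.1 hp.2.2
    rwa [sup_eq_right.2 hle'] at h

theorem mem_iff_eq_zero_or_exists_mem_filterOf (hm : m.IsMaximal) (a : E.Internal i₀ A) :
    a ∈ m ↔ a = 0 ∨ ∃ S ∈ filterOf m, ∀ p : E.InternalMax i₀ A,
      p.MemSet S ↔ a ∈ p.toIdeal := by
  refine ⟨fun h => or_iff_not_imp_left.2 fun ha => exists_vanishing_set_mem_filterOf ha h, ?_⟩
  rintro (rfl | ⟨S, hS, h⟩)
  · exact m.zero_mem
  · exact mem_of_forall_memSet hm hS fun p => (h p).1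

theorem diag_mem_vanishingIdeal_iff (hm : m.IsMaximal) (b : E.Internal i₀ A) :
    diag b ∈ vanishingIdeal (filterOf m) ↔ b ∈ m := by
  constructor
  · intro h
    obtain ⟨S, hS, h⟩ := exists_mem_vanishing_of_mem_vanishingIdeal (isLatticeFilter_filterOf m)
      (filterOf_nonempty hm) h
    exact mem_of_forall_memSet hm hS fun p hp => (eval_diag_eq_zero_iff b p).1 (h p hp)
  · intro h
    obtain ⟨T, hT⟩ := filterOf_nonempty hm
    obtain ⟨S, hS⟩ : ∃ S ∈ filterOf m, ∀ p : E.InternalMax i₀ A, p.MemSet S → b ∈ p.toIdeal := by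
      by_cases hb : b = 0
      · exact ⟨T, hT, fun p _ => hb ▸ zero_mem _⟩
      · obtain ⟨S, hS, h⟩ := exists_vanishing_set_mem_filterOf hb h
        exact ⟨S, hS, fun p => (h p).1⟩
    exact mem_vanishingIdeal hS.1 fun p hp => (eval_diag_eq_zero_iff b p).2 (hS.2 p hp)

theorem exists_quotient_ringEquiv_ultraproduct (hm : m.IsMaximal) :
    ∃ e : (E.Internal i₀ A ⧸ m) ≃+* Ultraproduct (filterOf m),
      ∀ b, e (Ideal.Quotient.mk m b) = Ideal.Quotient.mk _ (diag b) := by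
  let φ : E.Internal i₀ A →+* Ultraproduct (filterOf m) :=
    (Ideal.Quotient.mk _).comp diagHom
  have hker : RingHom.ker φ = m := by
    ext b
    rw [RingHom.mem_ker]
    exact Ideal.Quotient.eq_zero_iff_mem.trans (diag_mem_vanishingIdeal_iff hm b)
  have hφ : Function.Surjective φ := by
    intro x
    obtain ⟨f, rfl⟩ := Ideal.Quotient.mk_surjective x
    -- Any one member of the filter suffices: `f` agrees with some `diag b` on it.
    obtain ⟨T, hT⟩ := filterOf_nonempty hm
    obtain ⟨b, hb⟩ := exists_forall_eval_sub_diag_eq_zero f T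
    exact ⟨b, ((Ideal.Quotient.mk_eq_mk_iff_sub_mem _ _).2 (mem_vanishingIdeal hT hb)).symm⟩
  exact ⟨(Ideal.quotEquivOfEq hker.symm).trans (RingHom.quotientKerEquivOfSurjective hφ),
    fun b => rfl⟩

/-- Every generating set `V(a)` contains `p`, hence so does every member of the filter. This rules
out `T \ {p}`, so the dichotomy leaves `{p}`. -/
theorem isLeast_singleton_filterOf {p : E.InternalMax i₀ A} (hm : p.toIdeal.IsMaximal) :
    IsLeast (filterOf p.toIdeal) p.singleton := by
  constructor
  · obtain ⟨T, hT⟩ := filterOf_nonempty hm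
    obtain ⟨D, hD⟩ := HyperfiniteSets.exists_diff T p.singleton
    refine (mem_filterOf_or_diff_mem hm hT hD).resolve_right ?_
    rintro ⟨t, ht, hDt⟩
    exact ((hD p).1 (hDt p ht)).2 (InternalMax.memSet_singleton.2 rfl)
  · rintro S ⟨t, ht, hS⟩
    rw [HyperfiniteSets.le_iff]
    intro q hq
    rw [InternalMax.memSet_singleton] at hq
    exact hq ▸ hS p ht

theorem exists_ultraproduct_ringEquiv_residue {p : E.InternalMax i₀ A}
    (hm : p.toIdeal.IsMaximal) :
    ∃ e : Ultraproduct (filterOf p.toIdeal) ≃+* InternalResidue p,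
      ∀ f, e (Ideal.Quotient.mk _ f) = f.eval p := by
  have hker : RingHom.ker (InternalProd.evalHom p) = vanishingIdeal (filterOf p.toIdeal) := by
    ext f
    constructor
    · intro h
      refine mem_vanishingIdeal (isLeast_singleton_filterOf hm).1 fun q hq => ?_
      rw [InternalMax.memSet_singleton] at hq
      exact hq ▸ h
    · intro h
      obtain ⟨S, hS, h⟩ := exists_mem_vanishing_of_mem_vanishingIdeal
        (isLatticeFilter_filterOf _) (filterOf_nonempty hm) h
      exact h p (HyperfiniteSets.le_iff.1 ((isLeast_singleton_filterOf hm).2 hS) p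
        (InternalMax.memSet_singleton.2 rfl))
  exact ⟨(Ideal.quotEquivOfEq hker.symm).trans
    (RingHom.quotientKerEquivOfSurjective (InternalProd.evalHom_surjective p)), fun f => rfl⟩

end Dedekind

/-- A proper internal ideal lies in an internal maximal ideal `p`; maximality of `m` and properness
of `p` force equality. -/
theorem IsInternalIdeal.exists_internalMax (hm : m.IsMaximal) (h : IsInternalIdeal m) :
    ∃ p : E.InternalMax i₀ A, p.toIdeal = m := by
  obtain ⟨J, rfl⟩ := h
  obtain ⟨p, hp⟩ := InternalIdeal.exists_le_internalMax hm.ne_top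
  exact ⟨p, (hm.eq_of_le p.toIdeal_ne_top hp).symm⟩

end Rings

end NonstandardExtension

theorem mainTheorem4 (E : NonstandardExtension.{u, v}) {I : Type u} (i₀ : E.star I)
    (A : I → Type u) [∀ i, CommRing (A i)] [∀ i, IsDedekindDomain (A i)]
    (m : Ideal (E.Internal i₀ A)) (hm : m.IsMaximal) :
    IsLatticeUltrafilter (NonstandardExtension.filterOf m) ∧
    (∀ a, a ∈ m ↔ a = 0 ∨ ∃ S ∈ NonstandardExtension.filterOf m, ∀ p : E.InternalMax i₀ A,
      p.MemSet S ↔ a ∈ p.toIdeal) ∧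
    (∃ e : (E.Internal i₀ A ⧸ m) ≃+* NonstandardExtension.Ultraproduct (NonstandardExtension.filterOf m),
      ∀ b, e (Ideal.Quotient.mk m b) = Ideal.Quotient.mk _ (NonstandardExtension.diag b)) ∧
    (NonstandardExtension.IsInternalIdeal m →
      IsPrincipalFilter (NonstandardExtension.filterOf m) ∧
      ∃ p : E.InternalMax i₀ A, p.toIdeal = m ∧ IsLeast (NonstandardExtension.filterOf m) p.singleton ∧
        (∃ e : NonstandardExtension.Ultraproduct (NonstandardExtension.filterOf m) ≃+* NonstandardExtension.InternalResidue p,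
          ∀ f, e (Ideal.Quotient.mk _ f) = f.eval p) ∧
        (∃ e : (E.Internal i₀ A ⧸ m) ≃+* NonstandardExtension.InternalResidue p,
          ∀ b, e (Ideal.Quotient.mk m b) = (NonstandardExtension.diag b).eval p)) := by
  refine ⟨NonstandardExtension.isLatticeUltrafilter_filterOf hm,
    NonstandardExtension.mem_iff_eq_zero_or_exists_mem_filterOf hm,
    NonstandardExtension.exists_quotient_ringEquiv_ultraproduct hm, fun hint => ?_⟩
  obtain ⟨p, rfl⟩ := hint.exists_internalMax hm
  have hleast := NonstandardExtension.isLeast_singleton_filterOf hm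
  obtain ⟨e, he⟩ := NonstandardExtension.exists_quotient_ringEquiv_ultraproduct hm
  obtain ⟨e', he'⟩ := NonstandardExtension.exists_ultraproduct_ringEquiv_residue hm
  refine ⟨⟨_, hleast⟩, p, rfl, hleast, ⟨e', he'⟩, e.trans e', fun b => ?_⟩
  rw [RingEquiv.trans_apply, he, he']
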